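/- For a permutation $\pi$ of $[n]=\{1,\dots,n\}$ let $\mathrm{Des}(\pi)=\{i : 1\le i\le n-1,\ \pi(i)>\pi(i+1)\}$ be its descent set and let $\mathrm{bl}(\pi)=|\{i\in[n] : \pi(j)\le i \text{ for all } j\le i\}|$ be its block number. Call $\pi$ $321$-avoiding if there are no $a<b<c$ in $[n]$ with $\pi(a)>\pi(b)>\pi(c)$, and let $Bl_{n,k}$ be the set of $321$-avoiding permutations $\pi$ of $[n]$ with $\mathrm{bl}(\pi)=k$. For integers $a\ge b\ge 0$ let $\mathrm{SYT}(a,b)$ be the set of standard Young tableaux of two-row shape $(a,b)$, that is, with $a$ cells in the first (upper) row and $b$ cells in the second (for $a=b=0$ there is exactly one, the empty tableau). The descent set $\mathrm{Des}(T)$ of a tableau $T$ is the set of all $i$ such that $i+1$ appears in a strictly lower row of $T$ than $i$. For a finite set $I$ of positive integers write $\mathbf{x}^I=\prod_{i\in I}x_i$, where $x_1,x_2,\dots$ are commuting indeterminates. Then for all integers $1\le k\le n$, $$\sum_{\pi\in Bl_{n,k}}\mathbf{x}^{\mathrm{Des}(\pi)}=\sum_{T\in\mathrm{SYT}(n-1,\,n-k)}\mathbf{x}^{\mathrm{Des}(T)\cap[n-1]}.$$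 -/

import Mathlib

/- Permutations of `[n] = {1, …, n}` are elements of `Equiv.Perm (Fin n)`: the position or value `i`
of `[n]` is represented by the element of `Fin n` whose underlying natural number is `i - 1`. -/

namespace BlockNumber

/-- The descent set `Des(π) = {i : π(i) > π(i+1)}`, as a set of positions in `{1, …, n-1}`: the
zero-based position `i` contributes the one-based position `i + 1`. -/
def permDes {n : ℕ} (π : Equiv.Perm (Fin n)) : Finset ℕ :=
  (Finset.univ.filter fun i : Fin n =>
    ∃ h : (i : ℕ) + 1 < n, π ⟨(i : ℕ) + 1, h⟩ < π i).image fun i : Fin n => (i : ℕ) + 1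

/-- `π` is `321`-avoiding: the sequence `(π(1), …, π(n))` has no decreasing subsequence of
length `3`. -/
def Avoids321 {n : ℕ} (π : Equiv.Perm (Fin n)) : Prop :=
  ¬ ∃ a b c : Fin n, a < b ∧ b < c ∧ π c < π b ∧ π b < π a

instance {n : ℕ} : DecidablePred (Avoids321 (n := n)) :=
  fun _ => inferInstanceAs (Decidable (¬ _))

/-- The block number `bl(π) = |{i ∈ [n] : (∀ j ≤ i) π(j) ≤ i}|`. -/
def blockNumber {n : ℕ} (π : Equiv.Perm (Fin n)) : ℕ :=
  (Finset.univ.filter fun i : Fin n => ∀ j : Fin n, j ≤ i → π j ≤ i).card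

/-- `Bl_{n,k}`: the `321`-avoiding permutations of `[n]` with block number `k`. -/
def Bl (n k : ℕ) : Finset (Equiv.Perm (Fin n)) :=
  Finset.univ.filter fun π => Avoids321 π ∧ blockNumber π = k

/-- A filling of the cells of a Young diagram by `1, …, |μ|`, each used exactly once (the entry `m`
being represented by the element `m - 1` of `Fin μ.card`), is standard if the entries increase
from left to right along each row and from top to bottom along each column. Cells are pairs
`(row, column)` in the English convention. -/
def IsStandard {μ : YoungDiagram} (T : {c // c ∈ μ.cells} ≃ Fin μ.card) : Prop :=
  (∀ c d : {c // c ∈ μ.cells}, c.1.1 = d.1.1 → c.1.2 < d.1.2 → T c < T d) ∧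
  (∀ c d : {c // c ∈ μ.cells}, c.1.2 = d.1.2 → c.1.1 < d.1.1 → T c < T d)

instance {μ : YoungDiagram} : DecidablePred (IsStandard (μ := μ)) :=
  fun _ => inferInstanceAs (Decidable (_ ∧ _))

/-- `SYT(μ)`: the set of standard Young tableaux of shape `μ`. -/
def SYT (μ : YoungDiagram) : Finset ({c // c ∈ μ.cells} ≃ Fin μ.card) :=
  Finset.univ.filter IsStandard

/-- The descent set of a tableau: the entries `i` such that `i + 1` appears in a strictly lower row
(that is, one with a larger row index) than `i`. As for permutations, the zero-based `i`
contributes the one-based entry `i + 1`. -/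
def tabDes {μ : YoungDiagram} (T : {c // c ∈ μ.cells} ≃ Fin μ.card) : Finset ℕ :=
  (Finset.univ.filter fun i : Fin μ.card =>
    ∃ h : (i : ℕ) + 1 < μ.card, (T.symm i).1.1 < (T.symm ⟨(i : ℕ) + 1, h⟩).1.1).image
      fun i : Fin μ.card => (i : ℕ) + 1

/-- The Young diagram of the shape `(a, b)`, with `a` cells in the first row and `b ≤ a` cells in
the second; `b` and `a` may be `0`. -/
def twoRow (a b : ℕ) (h : b ≤ a) : YoungDiagram :=
  YoungDiagram.ofRowLens [a, b] (by simpa [List.sortedGE_iff_pairwise] using h)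

/-- The monomial `x^I = ∏_{i ∈ I} x_i` in the polynomial ring with integer coefficients in the
indeterminates `x_0, x_1, x_2, …`. -/
noncomputable def monom (I : Finset ℕ) : MvPolynomial ℕ ℤ :=
  ∏ i ∈ I, MvPolynomial.X i

end BlockNumber

/-!
A `321`-avoiding permutation `π` of `[n]` is determined by its running maxima
`M i = max (π(1), …, π(i))`, which form an arbitrary sequence `0 = M 0 ≤ M 1 ≤ … ≤ M n = n` with
`i ≤ M i` (`Avoids321.eq_of_runMax_eq`, `exists_avoids321_runMax_eq`). A block ends at `i` iff
`M i = i`, and `i` is a descent iff `M (i - 1) < M i = M (i + 1)`. So the left side counts paths of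
the excess `t = M i - i` with steps `U` (up by any `j ≥ 0`) and `D` (down by one), the descents being
the occurrences of `UD`. A two-row standard tableau is likewise a path of the difference `h` of the
row lengths, with steps `U` (up by one) and `D` (down by one), and its descents are again the
occurrences of `UD`.

For any two operators `U`, `D`, the sum `Γ n` of `x^Des(w) w` over the words `w` of length `n`
satisfies `Γ (n + 2) = Γ (n + 1) (U + D) + (x_{n+1} - 1) Γ n U D`. For tableaux `UD` is the identity.
For the excess paths, with a variable `q` marking the arrivals at `0`, the operators `UD` and `U + D`
coincide: both go from `t` to every `t' ≥ t - 1`. Hence the generating functions `b n` and `a n` of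
the two kinds of paths satisfy (`isBallotRec_ballotSum`, `isMaxRec_maxSum`)
* `b (n + 2) = X b (n + 1) + (x_{n+1} - 1) b n`, where `X` is the operator `walkOp` of the `±1` walk;
* `a (n + 2) = Y a (n + 1) + (x_{n+1} - 1) Y a n`, where
  `(Y a) t = q ^ [t = 0] * ∑ s ≤ t + 1, a s`.

Formally `Y` behaves like `X ^ 2` and `a n` like `X ^ n` applied to `b n`. The precise form of this is
`IsMaxRec.coeff_eq`, proved by induction from the recurrences alone: for `k < n`, the coefficient of
`q ^ k` in `a n 0` is the value at `k - 1` of `X ^ (n - k - 1)` applied to `b n`. When the weights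
`x i` with `i ≥ n` are replaced by `1`, the last function is `b (2 n - k - 1)`
(`IsBallotRec.add_eq_pow`), and its value at `k - 1` is the sum over the standard tableaux of shape
`(n - 1, n - k)` with only the descents in `[n - 1]` recorded. The case `k = n`, where the exponent
would be `-1`, concerns the identity and the one-row tableau only.
-/

namespace BlockNumber

open Finset Polynomial

variable {R : Type*} [CommRing R]

/-! ### Two recurrences and their relation -/

/-- The transfer operator of the simple walk on `ℕ` (steps `±1`, no step below `0`), acting on
functions of the endpoint. -/
def walkOp : (ℕ → R) →ₗ[R] (ℕ → R) where
  toFun b h := b (h + 1) + (if h = 0 then 0 else b (h - 1))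
  map_add' b c := by
    ext h
    by_cases hh : h = 0 <;> simp [hh, add_add_add_comm]
  map_smul' r b := by
    ext h
    by_cases hh : h = 0 <;> simp [hh, mul_add]

theorem walkOp_apply_zero (b : ℕ → R) : walkOp b 0 = b 1 := by
  simp [walkOp]

theorem walkOp_apply_succ (b : ℕ → R) (h : ℕ) : walkOp b (h + 1) = b (h + 2) + b h := by
  simp [walkOp]

theorem walkOp_pow_succ (m : ℕ) (b : ℕ → R) :
    (walkOp ^ (m + 1)) b = (walkOp ^ m) (walkOp b) := by
  rw [pow_succ]; rfl

theorem walkOp_pow_succ' (m : ℕ) (b : ℕ → R) :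
    (walkOp ^ (m + 1)) b = walkOp ((walkOp ^ m) b) := by
  rw [pow_succ']; rfl

theorem walkOp_pow_succ_apply_zero (m : ℕ) (b : ℕ → R) :
    (walkOp ^ (m + 1)) b 0 = (walkOp ^ m) b 1 := by
  rw [walkOp_pow_succ', walkOp_apply_zero]

theorem walkOp_pow_succ_apply_succ (m : ℕ) (b : ℕ → R) (h : ℕ) :
    (walkOp ^ (m + 1)) b (h + 1) = (walkOp ^ m) b (h + 2) + (walkOp ^ m) b h := by
  rw [walkOp_pow_succ', walkOp_apply_succ]

/-- The three-term recurrence of a sum over `±1` walks on `ℕ` in which every peak at time `i`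
contributes `x i`; `b N h` collects the walks of length `N` ending at height `h`. -/
structure IsBallotRec (x : ℕ → R) (b : ℕ → ℕ → R) : Prop where
  zero : b 0 = Pi.single 0 1
  one : b 1 = walkOp (b 0)
  step : ∀ n, b (n + 2) = walkOp (b (n + 1)) + (x (n + 1) - 1) • b n

/-- The three-term recurrence of a sum over running maxima: `a n t` collects the initial segments of
length `n` whose maximum is `n + t`, the variable of `R[X]` marking the blocks. -/
structure IsMaxRec (x : ℕ → R) (a : ℕ → ℕ → R[X]) : Prop where
  zero : a 0 = Pi.single 0 1
  one : ∀ t, a 1 t = if t = 0 then X else 1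
  step : ∀ n t, a (n + 2) t =
    (if t = 0 then X else 1) * ∑ s ∈ range (t + 2), (a (n + 1) s + C (x (n + 1) - 1) * a n s)

namespace IsBallotRec

variable {x : ℕ → R} {b : ℕ → ℕ → R}

theorem walkOp_pow_support {f : ℕ → R} {n : ℕ} (hf : ∀ h, n < h → f h = 0) (hn : f n = 1) (m : ℕ) :
    (∀ h, m + n < h → (walkOp ^ m) f h = 0) ∧ (walkOp ^ m) f (m + n) = 1 := by
  induction m with
  | zero => simpa using ⟨hf, hn⟩
  | succ m ih =>
    constructor
    · intro h hh
      obtain ⟨h, rfl⟩ : ∃ h', h = h' + 1 := ⟨h - 1, by omega⟩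
      rw [walkOp_pow_succ_apply_succ, ih.1 _ (by omega), ih.1 _ (by omega), add_zero]
    · rw [show m + 1 + n = m + n + 1 by ring, walkOp_pow_succ_apply_succ, ih.1 _ (by omega), ih.2,
        zero_add]

theorem support (hb : IsBallotRec x b) (n : ℕ) : (∀ h, n < h → b n h = 0) ∧ b n n = 1 := by
  induction n using Nat.twoStepInduction with
  | zero => simp +contextual [hb.zero, Nat.pos_iff_ne_zero]
  | one =>
    rw [hb.one, hb.zero]
    refine ⟨fun h hh => ?_, by simp [walkOp]⟩
    obtain ⟨h, rfl⟩ : ∃ h', h = h' + 2 := ⟨h - 2, by omega⟩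
    simp [walkOp_apply_succ]
  | more n ih0 ih1 =>
    rw [hb.step]
    have h1 := walkOp_pow_support ih1.1 ih1.2 1
    rw [pow_one, show 1 + (n + 1) = n + 2 by ring] at h1
    refine ⟨fun h hh => ?_, ?_⟩
    · simp [h1.1 h hh, ih0.1 h (by omega)]
    · simp [h1.2, ih0.1 (n + 2) (by omega)]

theorem pow_support (hb : IsBallotRec x b) (n m : ℕ) :
    (∀ h, m + n < h → (walkOp ^ m) (b n) h = 0) ∧ (walkOp ^ m) (b n) (m + n) = 1 :=
  walkOp_pow_support (hb.support n).1 (hb.support n).2 m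

theorem pow_step (hb : IsBallotRec x b) (n m h : ℕ) :
    (walkOp ^ m) (b (n + 2)) h =
      (walkOp ^ (m + 1)) (b (n + 1)) h + (x (n + 1) - 1) * (walkOp ^ m) (b n) h := by
  rw [hb.step, map_add, map_smul, ← walkOp_pow_succ]
  simp

/-- Once the peak weights are `1`, the recurrence is that of the unweighted walk. -/
theorem add_eq_pow (hb : IsBallotRec x b) {n : ℕ} (hn : 1 ≤ n) (hx : ∀ i, n ≤ i → x i = 1)
    (m : ℕ) : b (n + m) = (walkOp ^ m) (b n) := by
  induction m with
  | zero => simp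
  | succ m ih =>
    obtain ⟨l, rfl⟩ : ∃ l, n = l + 1 := ⟨n - 1, by omega⟩
    rw [walkOp_pow_succ', ← ih, show l + 1 + (m + 1) = (l + m) + 2 by ring, hb.step,
      hx _ (by omega), show l + m + 1 = l + 1 + m by ring]
    simp

end IsBallotRec

namespace IsMaxRec

variable {x : ℕ → R} {a : ℕ → ℕ → R[X]}

theorem coeff_step_succ (ha : IsMaxRec x a) (n k t : ℕ) : (a (n + 2) (t + 1)).coeff k =
    ∑ s ∈ range (t + 3), ((a (n + 1) s).coeff k + (x (n + 1) - 1) * (a n s).coeff k) := by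
  rw [ha.step]
  simp only [Nat.succ_ne_zero, if_false, one_mul, finsetSum_coeff, coeff_add, coeff_C_mul]

theorem coeff_step_zero (ha : IsMaxRec x a) (n k : ℕ) : (a (n + 2) 0).coeff (k + 1) =
    ∑ s ∈ range 2, ((a (n + 1) s).coeff k + (x (n + 1) - 1) * (a n s).coeff k) := by
  rw [ha.step]
  simp only [if_true, coeff_X_mul, finsetSum_coeff, coeff_add, coeff_C_mul, zero_add]

theorem coeff_zero (ha : IsMaxRec x a) (n : ℕ) : (a (n + 1) 0).coeff 0 = 0 := by
  cases n with
  | zero => simp [ha.one]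
  | succ n => rw [ha.step]; simp

/-- There are at most `n` blocks among `n` letters, and `n` blocks occur in one way only, with
maximum `n`. -/
theorem coeff_top (ha : IsMaxRec x a) (n : ℕ) : (∀ k t, n < k → (a n t).coeff k = 0) ∧
    (∀ t, (a n (t + 1)).coeff n = 0) ∧ (a n 0).coeff n = 1 := by
  induction n using Nat.twoStepInduction with
  | zero =>
    rw [ha.zero]
    refine ⟨fun k t hk => ?_, fun t => by simp, by simp⟩
    cases t <;> simp [coeff_one, hk.ne']
  | one =>
    refine ⟨fun k t hk => ?_, fun t => ?_, ?_⟩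
    · rw [ha.one]
      split_ifs
      · simp [coeff_X, hk.ne]
      · simp [coeff_one]; omega
    · simp [ha.one, coeff_one]
    · simp [ha.one]
  | more n ih0 ih1 =>
    have h : ∀ k s, n + 2 ≤ k →
        (a (n + 1) s).coeff k + (x (n + 1) - 1) * (a n s).coeff k = 0 := fun k s hk => by
      rw [ih1.1 _ _ (by omega), ih0.1 _ _ (by omega)]; ring
    refine ⟨fun k t hk => ?_, fun t => ?_, ?_⟩
    · cases t with
      | zero =>
        obtain ⟨k, rfl⟩ : ∃ k', k = k' + 1 := ⟨k - 1, by omega⟩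
        rw [ha.coeff_step_zero]
        exact sum_eq_zero fun s _ => h _ _ (by omega)
      | succ t =>
        rw [ha.coeff_step_succ]
        exact sum_eq_zero fun s _ => h _ _ (by omega)
    · rw [ha.coeff_step_succ]
      exact sum_eq_zero fun s _ => h _ _ (by omega)
    · rw [ha.coeff_step_zero, sum_range_succ, sum_range_one, ih1.2.2, ih1.2.1 0,
        ih0.1 _ _ (by omega), ih0.1 _ _ (by omega)]
      ring

/-- The solution of one recurrence in terms of the other. The first conjunct is the case of
interest; the second, for a positive excess `t + 1` of the maximum, makes the induction work. -/
theorem coeff_eq {b : ℕ → ℕ → R} (ha : IsMaxRec x a) (hb : IsBallotRec x b) (n : ℕ) :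
    (∀ m k, m + k + 2 = n → (a n 0).coeff (k + 1) = (walkOp ^ m) (b n) k) ∧
    (∀ m k t, m + k + 1 = n + t → (a n (t + 1)).coeff k = (walkOp ^ m) (b n) (t + 1 + k)) := by
  induction n using Nat.twoStepInduction with
  | zero =>
    refine ⟨fun m k h => by omega, fun m k t h => ?_⟩
    rw [(hb.pow_support 0 m).1 _ (by omega), ha.zero]
    simp
  | one =>
    refine ⟨fun m k h => by omega, fun m k t h => ?_⟩
    rw [ha.one]
    rcases Nat.eq_zero_or_pos k with rfl | hk
    · have := (hb.pow_support 1 m).2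
      rw [show t + 1 + 0 = m + 1 by omega, this]
      simp
    · rw [(hb.pow_support 1 m).1 _ (by omega)]
      simp [coeff_one, hk.ne']
  | more n ih0 ih1 =>
    have hz : ∀ m k, m + k = n → (a (n + 2) 0).coeff (k + 1) = (walkOp ^ m) (b (n + 2)) k := by
      intro m k h
      rw [ha.coeff_step_zero, hb.pow_step, sum_range_succ, sum_range_one]
      have e1 : (a (n + 1) 0).coeff k + (a (n + 1) 1).coeff k =
          (walkOp ^ (m + 1)) (b (n + 1)) k := by
        have := ih1.2 m k 0 (by omega)
        rw [zero_add] at this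
        rw [this]
        cases k with
        | zero => rw [ha.coeff_zero, walkOp_pow_succ_apply_zero, zero_add]
        | succ k =>
          rw [walkOp_pow_succ_apply_succ, ih1.1 m k (by omega), add_comm,
            show 1 + (k + 1) = k + 2 by ring]
      have e2 : (a n 0).coeff k + (a n 1).coeff k = (walkOp ^ m) (b n) k := by
        cases m with
        | zero =>
          obtain rfl : k = n := by omega
          rw [(ha.coeff_top k).2.2, (ha.coeff_top k).2.1 0, add_zero]
          simpa using (hb.support k).2.symm
        | succ m =>
          have := ih0.2 m k 0 (by omega)
          rw [zero_add] at this
          rw [this]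
          cases k with
          | zero =>
            obtain ⟨n, rfl⟩ : ∃ n', n = n' + 1 := ⟨n - 1, by omega⟩
            rw [ha.coeff_zero, walkOp_pow_succ_apply_zero, zero_add]
          | succ k =>
            rw [walkOp_pow_succ_apply_succ, ih0.1 m k (by omega), add_comm,
              show 1 + (k + 1) = k + 2 by ring]
      rw [← e1, ← e2]
      ring
    -- The partial sums of the recurrence are, up to the factor marking a block at `t = 0`, the values
    -- of `a (n + 2)`; consecutive ones differ by a single term.
    have key : ∀ k t m, m + k = n + t →
        ∑ s ∈ range (t + 2), ((a (n + 1) s).coeff k + (x (n + 1) - 1) * (a n s).coeff k) =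
          (walkOp ^ m) (b (n + 2)) (t + k) := by
      intro k t
      induction t with
      | zero =>
        intro m h
        rw [← ha.coeff_step_zero, hz m k (by omega), zero_add]
      | succ t iht =>
        intro m h
        rw [sum_range_succ]
        cases m with
        | zero =>
          cases t with
          | zero =>
            obtain rfl : k = n + 1 := by omega
            rw [← ha.coeff_step_zero, (ha.coeff_top (n + 2)).2.2, (ha.coeff_top (n + 1)).2.1,
              (ha.coeff_top n).1 _ _ (by omega), show 0 + 1 + (n + 1) = n + 2 by ring]
            simp [(hb.support (n + 2)).2]
          | succ t =>
            rw [(hb.pow_support (n + 2) 0).1 _ (by omega), ← sum_range_succ]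
            refine sum_eq_zero fun s _ => ?_
            rw [(ha.coeff_top (n + 1)).1 _ _ (by omega), (ha.coeff_top n).1 _ _ (by omega)]
            ring
        | succ m =>
          rw [iht m (by omega), hb.pow_step, hb.pow_step, ih1.2 (m + 1) k (t + 1) (by omega),
            ih0.2 m k (t + 1) (by omega), show t + 1 + k = t + k + 1 by ring,
            walkOp_pow_succ_apply_succ (m + 1) (b (n + 1)), walkOp_pow_succ_apply_succ m (b n),
            show t + 1 + 1 + k = t + k + 2 by ring]
          ring
    refine ⟨fun m k h => hz m k (by omega), fun m k t h => ?_⟩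
    rw [ha.coeff_step_succ]
    exact key k (t + 1) m (by omega)

end IsMaxRec

/-! ### Sums over ballot sets -/

/-- A set `C` of zero-based entries is a ballot set if every initial segment of `ℕ` has at most half
of its elements in `C`. The second rows of two-row standard tableaux are ballot sets. -/
def IsBallot (C : Finset ℕ) : Prop := ∀ i, 2 * #{j ∈ C | j < i} ≤ i

open Classical in
/-- The ballot sets in `{0, …, N - 1}` whose complement exceeds them by `h` elements. -/
noncomputable def ballotSets (N h : ℕ) : Finset (Finset ℕ) :=
  {C ∈ (range N).powerset | IsBallot C ∧ 2 * #C + h = N}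

/-- The one-based descents of a tableau with second row `C`: the one-based entry `i` lies in the
first row and `i + 1`, which is zero-based `i`, in the second. Since `0 - 1 = 0`, the element `0` is
never counted. -/
def ballotDes (C : Finset ℕ) : Finset ℕ := {i ∈ C | i - 1 ∉ C}

/-- The sum of `∏ x i` over the descents `i` of the ballot sets in `ballotSets N h`. -/
noncomputable def ballotSum (x : ℕ → R) (N h : ℕ) : R :=
  ∑ C ∈ ballotSets N h, ∏ i ∈ ballotDes C, x i

theorem mem_ballotSets {N h : ℕ} {C : Finset ℕ} :
    C ∈ ballotSets N h ↔ C ⊆ range N ∧ IsBallot C ∧ 2 * #C + h = N := by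
  simp [ballotSets]

theorem card_filter_lt_insert {C : Finset ℕ} {N : ℕ} (hC : C ⊆ range N) (i : ℕ) :
    #{j ∈ insert N C | j < i} = #{j ∈ C | j < i} + if N < i then 1 else 0 := by
  have hN : N ∉ C := fun h => by simpa using hC h
  rw [filter_insert]
  split_ifs
  · rw [card_insert_of_notMem (by simp [hN])]
  · simp

theorem filter_lt_eq_self {C : Finset ℕ} {N i : ℕ} (hC : C ⊆ range N) (hi : N ≤ i) :
    {j ∈ C | j < i} = C :=
  filter_true_of_mem fun _ hj => (mem_range.1 (hC hj)).trans_le hi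

theorem isBallot_insert {C : Finset ℕ} {N : ℕ} (hC : C ⊆ range N) :
    IsBallot (insert N C) ↔ IsBallot C ∧ 2 * #C + 1 ≤ N := by
  constructor
  · refine fun h => ⟨fun i => ?_, ?_⟩
    · have := h i
      rw [card_filter_lt_insert hC] at this
      omega
    · have := h (N + 1)
      rw [card_filter_lt_insert hC, filter_lt_eq_self hC (by omega)] at this
      simp at this
      omega
  · rintro ⟨h, hN⟩ i
    rw [card_filter_lt_insert hC]
    split_ifs with hi
    · rw [filter_lt_eq_self hC hi.le]
      omega
    · simpa using h i

theorem IsBallot.two_mul_card_le {C : Finset ℕ} {N : ℕ} (h : IsBallot C) (hC : C ⊆ range N) :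
    2 * #C ≤ N := by
  simpa [filter_lt_eq_self hC le_rfl] using h N

theorem subset_range_of_notMem {C : Finset ℕ} {N : ℕ} (hC : C ⊆ range (N + 1)) (hN : N ∉ C) :
    C ⊆ range N := by
  rwa [range_add_one, subset_insert_iff_of_notMem hN] at hC

theorem filter_notMem_ballotSets_succ (N h : ℕ) :
    {C ∈ ballotSets (N + 1) (h + 1) | N ∉ C} = ballotSets N h := by
  ext C
  simp only [mem_filter, mem_ballotSets]
  constructor
  · rintro ⟨⟨h1, h2, h3⟩, h4⟩
    exact ⟨subset_range_of_notMem h1 h4, h2, by omega⟩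
  · rintro ⟨h1, h2, h3⟩
    exact ⟨⟨h1.trans (range_subset_range.2 (by omega)), h2, by omega⟩, fun h => by simpa using h1 h⟩

theorem filter_notMem_ballotSets_zero (N : ℕ) :
    {C ∈ ballotSets (N + 1) 0 | N ∉ C} = ∅ := by
  refine filter_eq_empty_iff.2 fun C hC hN => ?_
  obtain ⟨h1, h2, h3⟩ := mem_ballotSets.1 hC
  have := h2.two_mul_card_le (subset_range_of_notMem h1 hN)
  omega

theorem sum_filter_mem_ballotSets (N h : ℕ) (f : Finset ℕ → R) :
    ∑ C ∈ ballotSets (N + 1) h with N ∈ C, f C = ∑ C ∈ ballotSets N (h + 1), f (insert N C) := by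
  symm
  have hN : ∀ {C}, C ∈ ballotSets N (h + 1) → N ∉ C := fun hC hn => by
    simpa using (mem_ballotSets.1 hC).1 hn
  refine sum_bij' (fun C _ => insert N C) (fun C _ => C.erase N) ?_ ?_ ?_ ?_ ?_
  · intro C hC
    have hNC := hN hC
    obtain ⟨h1, h2, h3⟩ := mem_ballotSets.1 hC
    simp only [mem_filter, mem_ballotSets, mem_insert_self, and_true]
    refine ⟨?_, (isBallot_insert h1).2 ⟨h2, by omega⟩, ?_⟩
    · rw [range_add_one]
      exact insert_subset_insert _ h1
    · rw [card_insert_of_notMem hNC]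
      omega
  · intro C hC
    obtain ⟨hC, hNC⟩ := mem_filter.1 hC
    obtain ⟨h1, h2, h3⟩ := mem_ballotSets.1 hC
    have hE : C.erase N ⊆ range N :=
      subset_range_of_notMem ((erase_subset _ _).trans h1) (by simp)
    have hc := card_erase_add_one hNC
    rw [← insert_erase hNC, isBallot_insert hE] at h2
    exact mem_ballotSets.2 ⟨hE, h2.1, by omega⟩
  · exact fun C hC => erase_insert (hN hC)
  · exact fun C hC => insert_erase (mem_filter.1 hC).2
  · exact fun C hC => rfl

theorem ballotDes_insert {C : Finset ℕ} {N : ℕ} (hC : C ⊆ range (N + 1)) :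
    ballotDes (insert (N + 1) C) =
      if N ∈ C then ballotDes C else insert (N + 1) (ballotDes C) := by
  have h : ∀ i ∈ C, i < N + 1 := fun i hi => by simpa using hC hi
  ext i
  split_ifs with hN
  all_goals
    simp only [ballotDes, mem_filter, mem_insert]
    constructor
    · rintro ⟨rfl | hi, h2⟩ <;> simp_all
    · intro hi
      have := h i
      grind

theorem ballotSum_eq_add (x : ℕ → R) (N h : ℕ) : ballotSum x (N + 1) h =
    ∑ C ∈ ballotSets N (h + 1), ∏ i ∈ ballotDes (insert N C), x i +
      ∑ C ∈ ballotSets (N + 1) h with N ∉ C, ∏ i ∈ ballotDes C, x i := by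
  rw [ballotSum, ← sum_filter_add_sum_filter_not _ (fun C => N ∈ C), sum_filter_mem_ballotSets]

theorem sum_notMem_eq_walkOp (x : ℕ → R) (N h : ℕ) :
    ballotSum x N (h + 1) + ∑ C ∈ ballotSets (N + 1) h with N ∉ C, ∏ i ∈ ballotDes C, x i =
      walkOp (ballotSum x N) h := by
  cases h with
  | zero => simp [filter_notMem_ballotSets_zero, walkOp_apply_zero]
  | succ h => rw [filter_notMem_ballotSets_succ, walkOp_apply_succ]; rfl

theorem isBallotRec_ballotSum (x : ℕ → R) : IsBallotRec x (ballotSum x) where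
  zero := by
    ext h
    have : ballotSets 0 h = if h = 0 then {∅} else ∅ := by
      ext C
      split_ifs with hh
      · subst hh
        simp only [mem_ballotSets, range_zero, subset_empty, mem_singleton]
        exact ⟨fun h => h.1, by rintro rfl; simp [IsBallot]⟩
      · simp only [mem_ballotSets]
        constructor
        · omega
        · simp
    rw [ballotSum, this]
    split_ifs with hh <;> simp [hh, ballotDes]
  one := by
    ext h
    rw [ballotSum_eq_add, ← sum_notMem_eq_walkOp]
    congr 1
    refine sum_congr rfl fun C hC => ?_
    have : C = ∅ := by simpa using (mem_ballotSets.1 hC).1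
    simp [this, ballotDes, filter_singleton]
  step n := by
    ext h
    have key : ∑ C ∈ ballotSets (n + 1) (h + 1), ∏ i ∈ ballotDes (insert (n + 1) C), x i =
        ballotSum x (n + 1) (h + 1) + (x (n + 1) - 1) * ballotSum x n h := by
      rw [ballotSum, ballotSum, ← filter_notMem_ballotSets_succ n h, sum_filter, mul_sum,
        ← sum_add_distrib]
      refine sum_congr rfl fun C hC => ?_
      have hC := (mem_ballotSets.1 hC).1
      rw [ballotDes_insert hC]
      split_ifs with hN
      · simp
      · rw [prod_insert fun hm => by simpa using hC (mem_filter.1 hm).1]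
        ring
    rw [Pi.add_apply, Pi.smul_apply, smul_eq_mul, ← sum_notMem_eq_walkOp, ballotSum_eq_add, key]
    ring

/-! ### Sums over sequences of running maxima -/

/-- `M` up to time `n`, and the constant `v` afterwards. -/
def extendConst (n v : ℕ) (M : ℕ → ℕ) (i : ℕ) : ℕ := if i ≤ n then M i else v

open Classical in
/-- The sequences `0 = M 0 ≤ M 1 ≤ … ≤ M n = v` with `i ≤ M i`, continued by the constant `v`. For
`v = n` these are the sequences of running maxima `M i = max (π(1), …, π(i))` of permutations of
`[n]`. -/
noncomputable def maxSeqs : ℕ → ℕ → Finset (ℕ → ℕ)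
  | 0, v => if v = 0 then {fun _ => 0} else ∅
  | n + 1, v =>
    if n + 1 ≤ v then (range (v + 1)).biUnion fun u => (maxSeqs n u).image (extendConst n v) else ∅

/-- The positions where `M` has just increased and does not increase next. -/
def maxDes (n : ℕ) (M : ℕ → ℕ) : Finset ℕ := {i ∈ range n | M (i - 1) < M i ∧ M (i + 1) = M i}

/-- The number of positions in `{1, …, n}` fixed by `M`. -/
def maxBlocks (n : ℕ) (M : ℕ → ℕ) : ℕ := #{i ∈ range n | M (i + 1) = i + 1}

/-- The weight `∏ x i * X ^ bl` of a sequence of running maxima, the product being over its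
descents. -/
noncomputable def maxWeight (x : ℕ → R) (n : ℕ) (M : ℕ → ℕ) : R[X] :=
  (∏ i ∈ maxDes n M, C (x i)) * X ^ maxBlocks n M

/-- The sum of the weights of `maxSeqs n v`. -/
noncomputable def maxSum (x : ℕ → R) (n v : ℕ) : R[X] := ∑ M ∈ maxSeqs n v, maxWeight x n M

theorem mem_maxSeqs {n v : ℕ} {M : ℕ → ℕ} : M ∈ maxSeqs n v ↔
    M 0 = 0 ∧ (∀ i < n, M i ≤ M (i + 1)) ∧ (∀ i ≤ n, i ≤ M i) ∧ ∀ i, n ≤ i → M i = v := by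
  induction n generalizing v M with
  | zero =>
    rw [maxSeqs]
    split_ifs with hv
    · subst hv
      simp only [mem_singleton, funext_iff]
      constructor
      · intro h
        simp [h]
      · exact fun h i => h.2.2.2 i (by omega)
    · simp only [notMem_empty, false_iff]
      rintro ⟨h0, -, -, h⟩
      exact hv (by rw [← h 0 le_rfl, h0])
  | succ n ih =>
    rw [maxSeqs]
    split_ifs with hv
    · simp only [mem_biUnion, mem_image, ih, mem_range]
      constructor
      · rintro ⟨u, hu, M, ⟨h0, h1, h2, h3⟩, rfl⟩
        refine ⟨by simp [extendConst, h0], fun i hi => ?_, fun i hi => ?_, fun i hi => ?_⟩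
        · have := h1 i
          have := h3 i
          unfold extendConst
          split_ifs <;> omega
        · have := h2 i
          unfold extendConst
          split_ifs <;> omega
        · unfold extendConst
          split_ifs <;> omega
      · rintro ⟨h0, h1, h2, h3⟩
        refine ⟨M n, ?_, fun i => M (min i n), ⟨by simp [h0], fun i hi => ?_, fun i hi => ?_,
          fun i hi => by simp [hi]⟩, ?_⟩
        · have := h1 n (by omega)
          rw [h3 (n + 1) le_rfl] at this
          omega
        · simpa [min_eq_left hi.le, min_eq_left (Nat.succ_le_of_lt hi)] using h1 i (by omega)
        · simpa [min_eq_left hi] using h2 i (by omega)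
        · ext i
          unfold extendConst
          split_ifs with hi
          · simp [hi]
          · rw [h3 i (by omega)]
    · simp only [notMem_empty, false_iff]
      rintro ⟨-, -, h2, h3⟩
      have := h2 (n + 1) le_rfl
      rw [h3 (n + 1) le_rfl] at this
      omega

theorem maxSeqs_eq_empty {n v : ℕ} (h : v < n) : maxSeqs n v = ∅ := by
  refine eq_empty_of_forall_notMem fun M hM => ?_
  obtain ⟨-, -, h2, h3⟩ := mem_maxSeqs.1 hM
  have := h2 n le_rfl
  rw [h3 n le_rfl] at this
  omega

theorem sum_maxSeqs_succ {A : Type*} [AddCommMonoid A] {n v : ℕ} (hv : n + 1 ≤ v)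
    (f : (ℕ → ℕ) → A) : ∑ M ∈ maxSeqs (n + 1) v, f M =
      ∑ u ∈ range (v + 1), ∑ M ∈ maxSeqs n u, f (extendConst n v M) := by
  classical
  rw [maxSeqs, if_pos hv, sum_biUnion]
  · refine sum_congr rfl fun u _ => ?_
    rw [sum_image]
    intro M hM N hN h
    ext i
    rcases le_total i n with hi | hi
    · simpa [extendConst, hi] using congrFun h i
    · rw [(mem_maxSeqs.1 hM).2.2.2 i hi, (mem_maxSeqs.1 hN).2.2.2 i hi]
  · intro u _ w _ huw
    refine disjoint_left.2 fun M hM hN => huw ?_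
    obtain ⟨M', hM', rfl⟩ := mem_image.1 hM
    obtain ⟨N', hN', h⟩ := mem_image.1 hN
    have := congrFun h n
    simp only [extendConst, le_refl, if_true] at this
    rw [← (mem_maxSeqs.1 hM').2.2.2 n le_rfl, ← (mem_maxSeqs.1 hN').2.2.2 n le_rfl, this]

theorem maxBlocks_extendConst (n v : ℕ) (M : ℕ → ℕ) :
    maxBlocks (n + 1) (extendConst n v M) = maxBlocks n M + if v = n + 1 then 1 else 0 := by
  unfold maxBlocks
  rw [range_add_one, filter_insert]
  have : {i ∈ range n | extendConst n v M (i + 1) = i + 1} = {i ∈ range n | M (i + 1) = i + 1} :=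
    filter_congr fun i hi => by simp [extendConst, Nat.succ_le_of_lt (mem_range.1 hi)]
  rw [this]
  simp only [extendConst, Nat.not_succ_le_self, if_false]
  split_ifs <;> simp

theorem maxDes_extendConst {n u v : ℕ} {M : ℕ → ℕ} (hM : M ∈ maxSeqs n u) :
    maxDes (n + 1) (extendConst n v M) =
      if M (n - 1) < u ∧ v = u then insert n (maxDes n M) else maxDes n M := by
  have hu : M n = u := (mem_maxSeqs.1 hM).2.2.2 n le_rfl
  unfold maxDes
  rw [range_add_one, filter_insert]
  have : {i ∈ range n | extendConst n v M (i - 1) < extendConst n v M i ∧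
      extendConst n v M (i + 1) = extendConst n v M i} =
      {i ∈ range n | M (i - 1) < M i ∧ M (i + 1) = M i} :=
    filter_congr fun i hi => by
      have hi := mem_range.1 hi
      simp [extendConst, Nat.succ_le_of_lt hi, hi.le, (Nat.sub_le i 1).trans hi.le]
  rw [this]
  simp [extendConst, hu]

theorem maxWeight_extendConst (x : ℕ → R) {n u v : ℕ} {M : ℕ → ℕ} (hM : M ∈ maxSeqs n u) :
    maxWeight x (n + 1) (extendConst n v M) = (if v = n + 1 then X else 1) *
      (maxWeight x n M + if M (n - 1) < u ∧ v = u then C (x n - 1) * maxWeight x n M else 0) := by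
  unfold maxWeight
  rw [maxDes_extendConst hM, maxBlocks_extendConst]
  have : ∏ i ∈ insert n (maxDes n M), C (x i) = C (x n) * ∏ i ∈ maxDes n M, C (x i) :=
    prod_insert (by simp [maxDes])
  split_ifs
  all_goals
    simp only [this, C_sub, C_1, pow_add, pow_one, pow_zero]
    ring

theorem sum_range_maxSum (x : ℕ → R) (n t : ℕ) :
    ∑ u ∈ range (n + t), maxSum x n u = ∑ s ∈ range t, maxSum x n (n + s) := by
  rw [sum_range_add, sum_eq_zero, zero_add]
  intro u hu
  rw [maxSum, maxSeqs_eq_empty (mem_range.1 hu), sum_empty]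

/-- The sequences that increase at the last step. -/
theorem sum_maxWeight_of_lt (x : ℕ → R) {n v : ℕ} (hv : n + 2 ≤ v) :
    ∑ M ∈ maxSeqs (n + 1) v, (if M n < v then maxWeight x (n + 1) M else 0) =
      ∑ u ∈ range v, maxSum x n u := by
  rw [sum_maxSeqs_succ (by omega), sum_range_succ, add_eq_left.2]
  · refine sum_congr rfl fun u hu => sum_congr rfl fun M hM => ?_
    have hn : M n = u := (mem_maxSeqs.1 hM).2.2.2 n le_rfl
    have hu := mem_range.1 hu
    rw [maxWeight_extendConst x hM]
    simp [extendConst, hn, hu, hu.ne', show v ≠ n + 1 by omega]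
  · refine sum_eq_zero fun M hM => ?_
    have hn : M n = v := (mem_maxSeqs.1 hM).2.2.2 n le_rfl
    simp [extendConst, hn]

theorem maxSum_succ (x : ℕ → R) {n v : ℕ} (hv : n + 1 ≤ v) : maxSum x (n + 1) v =
    (if v = n + 1 then X else 1) * (∑ u ∈ range (v + 1), maxSum x n u +
      C (x n - 1) * ∑ M ∈ maxSeqs n v, if M (n - 1) < v then maxWeight x n M else 0) := by
  rw [maxSum, sum_maxSeqs_succ hv]
  have : ∀ u ∈ range (v + 1), ∑ M ∈ maxSeqs n u, maxWeight x (n + 1) (extendConst n v M) =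
      (if v = n + 1 then X else 1) * (maxSum x n u + if v = u then C (x n - 1) *
        ∑ M ∈ maxSeqs n v, (if M (n - 1) < v then maxWeight x n M else 0) else 0) := by
    intro u _
    rw [sum_congr rfl fun M hM => maxWeight_extendConst x hM, ← mul_sum, sum_add_distrib]
    congr 2
    by_cases huv : v = u
    · subst huv
      simp [mul_sum]
    · simp [huv]
  rw [sum_congr rfl this, ← mul_sum, sum_add_distrib, sum_ite_eq]
  simp

theorem isMaxRec_maxSum (x : ℕ → R) : IsMaxRec x fun n t => maxSum x n (n + t) where
  zero := by
    ext1 t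
    rcases Nat.eq_zero_or_pos t with rfl | ht
    · simp [maxSum, maxSeqs, maxWeight, maxDes, maxBlocks]
    · simp [maxSum, maxSeqs, ht.ne']
  one t := by
    have h : ∀ u, maxSum x 0 u = if u = 0 then 1 else 0 := by
      intro u
      split_ifs with hu <;> simp [maxSum, maxSeqs, hu, maxWeight, maxDes, maxBlocks]
    rw [maxSum_succ x (by omega), sum_congr rfl fun u _ => h u]
    simp [maxSeqs]
  step n t := by
    rw [maxSum_succ x (by omega), Nat.add_sub_cancel, sum_maxWeight_of_lt x (by omega),
      show n + 2 + t + 1 = n + 1 + (t + 2) by ring, sum_range_maxSum,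
      show n + 2 + t = n + (t + 2) by ring, sum_range_maxSum, sum_add_distrib, mul_sum]
    simp only [show n + (t + 2) = n + 1 + 1 ↔ t = 0 by omega]

/-! ### `321`-avoiding permutations and their running maxima -/

/-- The running maximum `max (π(1), …, π(i))`, in one-based values; it is `0` for `i = 0`. -/
def runMax {n : ℕ} (π : Equiv.Perm (Fin n)) (i : ℕ) : ℕ :=
  ({j : Fin n | (j : ℕ) < i} : Finset (Fin n)).sup fun j => (π j : ℕ) + 1

section runMax

variable {n : ℕ} (π : Equiv.Perm (Fin n))

theorem runMax_le_iff {i m : ℕ} : runMax π i ≤ m ↔ ∀ j : Fin n, (j : ℕ) < i → (π j : ℕ) < m := by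
  simp [runMax]

theorem lt_runMax {i : ℕ} {j : Fin n} (h : (j : ℕ) < i) : (π j : ℕ) < runMax π i :=
  (runMax_le_iff π).1 le_rfl j h

theorem runMax_zero : runMax π 0 = 0 := by
  simp [runMax]

theorem runMax_succ (i : Fin n) : runMax π (i + 1) = max (runMax π i) (π i + 1) := by
  refine eq_of_forall_ge_iff fun m => ?_
  simp only [max_le_iff, runMax_le_iff, Nat.succ_le_iff]
  constructor
  · exact fun h => ⟨fun j hj => h j (by omega), h i (by omega)⟩
  · rintro ⟨h, hi⟩ j hj
    rcases Nat.lt_succ_iff_lt_or_eq.1 hj with hj | hj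
    · exact h j hj
    · rwa [Fin.ext hj]

theorem card_filter_val_lt {i : ℕ} (hi : i ≤ n) : #{j : Fin n | (j : ℕ) < i} = i := by
  rw [← card_image_of_injective _ Fin.val_injective]
  convert card_range i
  ext j
  simp only [mem_image, mem_filter, mem_univ, true_and, mem_range]
  exact ⟨by rintro ⟨j, h, rfl⟩; exact h, fun h => ⟨⟨j, by omega⟩, h, rfl⟩⟩

theorem le_runMax {i : ℕ} (hi : i ≤ n) : i ≤ runMax π i := by
  have : #{j : Fin n | (j : ℕ) < i} ≤ #(range (runMax π i)) := by
    refine card_le_card_of_injOn (fun j => (π j : ℕ)) ?_ ?_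
    · intro j hj
      simpa using lt_runMax π (by simpa using hj)
    · exact (Fin.val_injective.comp π.injective).injOn
  rwa [card_filter_val_lt hi, card_range] at this

theorem runMax_of_le {i : ℕ} (hi : n ≤ i) : runMax π i = n := by
  refine le_antisymm ((runMax_le_iff π).2 fun j _ => (π j).2) ((le_runMax π le_rfl).trans ?_)
  exact (runMax_le_iff π).2 fun j _ => lt_runMax π (by omega)

theorem runMax_mem_maxSeqs : runMax π ∈ maxSeqs n n := by
  refine mem_maxSeqs.2 ⟨runMax_zero π, fun i hi => ?_, fun i => le_runMax π, fun i => runMax_of_le π⟩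
  have := runMax_succ π ⟨i, hi⟩
  simp only at this
  omega

/-- A letter that is not a left-to-right maximum has a larger letter to its left. -/
theorem exists_lt_of_runMax_eq {i : Fin n} (h : runMax π (i + 1) = runMax π i) :
    ∃ a < i, π i < π a := by
  by_contra! hc
  have h1 : runMax π i ≤ π i := (runMax_le_iff π).2 fun j hj =>
    lt_of_le_of_ne (hc j hj) fun he => by
      rw [π.injective (Fin.ext he)] at hj
      exact lt_irrefl _ hj
  have h2 := runMax_succ π i
  omega

theorem val_add_one_eq_runMax {i : Fin n} (h : runMax π i < runMax π (i + 1)) :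
    (π i : ℕ) + 1 = runMax π (i + 1) := by
  have := runMax_succ π i
  omega

variable {π}

/-- In a `321`-avoiding permutation, the letters that are not left-to-right maxima increase. -/
theorem Avoids321.lt_of_runMax_eq (hπ : Avoids321 π) {i j : Fin n} (hij : i < j)
    (hi : runMax π (i + 1) = runMax π i) : π i < π j := by
  by_contra! h
  obtain ⟨a, ha, hai⟩ := exists_lt_of_runMax_eq π hi
  exact hπ ⟨a, i, j, ha, hij, lt_of_le_of_ne h fun he => hij.ne (π.injective he).symm, hai⟩

theorem Avoids321.permDes_eq (hπ : Avoids321 π) : permDes π = maxDes n (runMax π) := by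
  ext m
  simp only [permDes, maxDes, mem_image, mem_filter, mem_univ, true_and, mem_range]
  constructor
  · rintro ⟨i, ⟨hi, hd⟩, rfl⟩
    have h1 := runMax_succ π i
    have h2 := runMax_succ π ⟨i + 1, hi⟩
    simp only at h2
    have hd' : (π ⟨i + 1, hi⟩ : ℕ) < π i := hd
    have h3 : runMax π (i + 1) ≠ runMax π i := fun h =>
      absurd (hπ.lt_of_runMax_eq (j := ⟨i + 1, hi⟩) (by simp [Fin.lt_def]) h) (not_lt.2 hd.le)
    rw [Nat.add_sub_cancel]
    omega
  · rintro ⟨hm, h1, h2⟩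
    obtain ⟨i, rfl⟩ : ∃ i, m = i + 1 := ⟨m - 1, by
      rcases Nat.eq_zero_or_pos m with rfl | h
      · simp at h1
      · omega⟩
    rw [Nat.add_sub_cancel] at h1
    refine ⟨⟨i, by omega⟩, ⟨hm, ?_⟩, rfl⟩
    have h3 := val_add_one_eq_runMax π (i := ⟨i, by omega⟩) h1
    have h4 := lt_runMax π (j := ⟨i + 1, hm⟩) (i := i + 1 + 1) (by simp)
    have h5 : π ⟨i + 1, hm⟩ ≠ π ⟨i, by omega⟩ := fun h => by simpa using π.injective h
    rw [Ne, Fin.ext_iff] at h5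
    rw [Fin.lt_def]
    simp only at h3 ⊢
    omega

variable (π) in
theorem blockNumber_eq : blockNumber π = maxBlocks n (runMax π) := by
  unfold blockNumber maxBlocks
  rw [← card_image_of_injective _ Fin.val_injective]
  congr 1
  ext m
  simp only [mem_image, mem_filter, mem_univ, true_and, mem_range]
  have key : ∀ i : Fin n, (∀ j, j ≤ i → π j ≤ i) ↔ runMax π (i + 1) = i + 1 := fun i => by
    have := le_runMax π (Nat.succ_le_of_lt i.2)
    rw [← this.ge_iff_eq', runMax_le_iff]
    simp only [Fin.le_def, Nat.lt_succ_iff]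
  constructor
  · rintro ⟨i, hi, rfl⟩
    exact ⟨i.2, (key i).1 hi⟩
  · rintro ⟨hm, h⟩
    exact ⟨⟨m, hm⟩, (key ⟨m, hm⟩).2 h, rfl⟩

theorem Avoids321.eq_of_runMax_eq {σ : Equiv.Perm (Fin n)} (hπ : Avoids321 π) (hσ : Avoids321 σ)
    (h : runMax π = runMax σ) : π = σ := by
  have hS : ∀ i : Fin n, runMax π i < runMax π (i + 1) → π i = σ i := fun i hi => by
    have h1 := val_add_one_eq_runMax π hi
    have h2 := val_add_one_eq_runMax σ (h ▸ hi)
    rw [h] at h1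
    exact Fin.ext (by omega)
  -- If `τ i < ρ i` at the first position where `τ` and `ρ` differ, then `ρ` takes the value `τ i` at
  -- an earlier position, which is impossible.
  have aux : ∀ (τ ρ : Equiv.Perm (Fin n)) (i : Fin n), Avoids321 ρ →
      (∀ j : Fin n, runMax ρ j < runMax ρ (j + 1) → τ j = ρ j) → (∀ j < i, τ j = ρ j) →
      ¬ τ i < ρ i := by
    intro τ ρ i hρ hS ih hlt
    have hj : ρ (ρ.symm (τ i)) = τ i := ρ.apply_symm_apply _
    generalize ρ.symm (τ i) = j at hj
    by_cases hjS : runMax ρ j < runMax ρ (j + 1)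
    · rw [← hS j hjS] at hj
      rw [← τ.injective hj, ← hS j hjS] at hlt
      exact lt_irrefl _ hlt
    · rcases lt_trichotomy j i with hji | rfl | hji
      · rw [← ih j hji] at hj
        exact hji.ne (τ.injective hj)
      · rw [hj] at hlt
        exact lt_irrefl _ hlt
      · have hiS : runMax ρ (i + 1) = runMax ρ i := by
          by_contra hne
          have hle : runMax ρ i ≤ runMax ρ (i + 1) :=
            (runMax_le_iff ρ).2 fun a ha => lt_runMax ρ (by omega)
          exact hlt.ne (hS i (by omega))
        exact absurd (hρ.lt_of_runMax_eq hji hiS) (not_lt.2 (hj ▸ hlt.le))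
  ext i : 1
  induction i using WellFoundedLT.induction with
  | ind i ih =>
    refine le_antisymm (not_lt.1 ?_) (not_lt.1 ?_)
    · exact aux σ π i hπ (fun j hj => (hS j hj).symm) fun j hj => (ih j hj).symm
    · exact aux π σ i hσ (fun j hj => hS j (h ▸ hj)) ih

end runMax

/-- The candidate for a permutation with running maxima `M`: the positions where `M` increases receive
the new maxima, the others receive the remaining values in increasing order. -/
theorem exists_perm_of_mem_maxSeqs {n : ℕ} {M : ℕ → ℕ} (hM : M ∈ maxSeqs n n) :
    ∃ π : Equiv.Perm (Fin n), (∀ i : Fin n, M i < M (i + 1) → (π i : ℕ) + 1 = M (i + 1)) ∧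
      ∀ i j : Fin n, M (i + 1) = M i → M (j + 1) = M j → i < j → π i < π j := by
  obtain ⟨h0, h1, h2, h3⟩ := mem_maxSeqs.1 hM
  have hmono : Monotone M := monotone_nat_of_le_succ fun i => by
    rcases lt_or_ge i n with hi | hi
    · exact h1 i hi
    · rw [h3 i hi, h3 (i + 1) (by omega)]
  have hle : ∀ i, M i ≤ n := fun i => by
    rw [← h3 _ (le_max_left n i)]
    exact hmono (le_max_right _ _)
  have hpos : ∀ i, i < n → 0 < M (i + 1) := fun i hi => by
    have := h2 (i + 1) hi
    omega
  let f : Fin n → Fin n := fun i => ⟨M (i + 1) - 1, by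
    have := hle (i + 1); have := hpos i i.2; omega⟩
  let S : Finset (Fin n) := {i | M i < M (i + 1)}
  have hS : ∀ i, i ∈ S ↔ M i < M (i + 1) := fun i => by simp [S]
  have hf : ∀ i : Fin n, (f i : ℕ) + 1 = M (i + 1) := fun i => by
    have := hpos i i.2
    simp only [f]
    omega
  have hfS : StrictMonoOn f S := by
    intro i _ j hj hij
    have h4 := (hS j).1 hj
    have h5 : M (i + 1) ≤ M j := hmono (Nat.succ_le_of_lt hij)
    have h6 := hf i
    have h7 := hf j
    rw [Fin.lt_def]
    omega
  have hc : #(S.image f)ᶜ = #Sᶜ := by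
    rw [card_compl, card_compl, card_image_of_injOn hfS.injOn]
  let g := ((Sᶜ).orderIsoOfFin rfl).symm.trans (((S.image f)ᶜ).orderIsoOfFin hc)
  let p : Fin n → Fin n := fun i =>
    if h : i ∈ S then f i else g ⟨i, mem_compl.2 h⟩
  have hpS : ∀ i ∈ S, p i = f i := fun i hi => dif_pos hi
  have hpC : ∀ i (h : i ∉ S), p i = g ⟨i, mem_compl.2 h⟩ := fun i hi => dif_neg hi
  have hne : ∀ i ∈ S, ∀ j ∉ S, p i ≠ p j := fun i hi j hj h => by
    rw [hpS i hi, hpC j hj] at h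
    have := mem_compl.1 (g ⟨j, mem_compl.2 hj⟩).2
    rw [← h] at this
    exact this (mem_image_of_mem f hi)
  have hp : Function.Injective p := by
    intro i j h
    by_cases hi : i ∈ S <;> by_cases hj : j ∈ S
    · rw [hpS i hi, hpS j hj] at h
      exact hfS.injOn hi hj h
    · exact absurd h (hne i hi j hj)
    · exact absurd h.symm (hne j hj i hi)
    · rw [hpC i hi, hpC j hj] at h
      simpa using g.injective (Subtype.ext h)
  refine ⟨Equiv.ofBijective p (Finite.injective_iff_bijective.1 hp), fun i hi => ?_,
    fun i j hi hj hij => ?_⟩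
  · rw [Equiv.ofBijective_apply, hpS i ((hS i).2 hi), hf]
  · have hi' : i ∉ S := by simp [hS, hi]
    have hj' : j ∉ S := by simp [hS, hj]
    simp only [Equiv.ofBijective_apply]
    rw [hpC i hi', hpC j hj']
    exact g.strictMono (by simpa using hij)

theorem exists_avoids321_runMax_eq {n : ℕ} {M : ℕ → ℕ} (hM : M ∈ maxSeqs n n) :
    ∃ π : Equiv.Perm (Fin n), Avoids321 π ∧ runMax π = M := by
  obtain ⟨π, hS, hC⟩ := exists_perm_of_mem_maxSeqs hM
  obtain ⟨h0, h1, h2, h3⟩ := mem_maxSeqs.1 hM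
  have hmono : Monotone M := monotone_nat_of_le_succ fun i => by
    rcases lt_or_ge i n with hi | hi
    · exact h1 i hi
    · rw [h3 i hi, h3 (i + 1) (by omega)]
  have hcase : ∀ i : Fin n, M i < M (i + 1) ∨ M (i + 1) = M i := fun i => by
    have := h1 i i.2
    omega
  -- If `π i ≥ M (i + 1)`, then all `M (i + 1) > i` values below `M (i + 1)` occur before `i`.
  have hlt : ∀ i : Fin n, (π i : ℕ) < M (i + 1) := by
    intro i
    rcases hcase i with hi | hi
    · have := hS i hi
      omega
    · by_contra! hge
      have : #(range (M (i + 1))) ≤ #(range (i : ℕ)) := by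
        refine card_le_card_of_surjOn (fun j => if h : j < n then (π ⟨j, h⟩ : ℕ) else 0) ?_
        intro u hu
        have hu : u < M (i + 1) := by simpa using hu
        obtain ⟨j, hj⟩ := π.surjective ⟨u, by have := (π i).2; omega⟩
        have hj : (π j : ℕ) = u := by rw [hj]
        refine ⟨j, ?_, by simp [hj]⟩
        rw [coe_range, Set.mem_Iio]
        by_contra! hij
        rcases hcase j with hjS | hjC
        · have h4 := hS j hjS
          rcases hij.eq_or_lt with hij | hij
          · rw [Fin.ext hij] at hi
            omega
          · have h5 : M (i + 1) ≤ M j := hmono hij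
            omega
        · rcases hij.eq_or_lt with hij | hij
          · obtain rfl := Fin.ext hij
            omega
          · have h5 : (π i : ℕ) < π j := hC i j hi hjC hij
            omega
      rw [card_range, card_range] at this
      have := h2 (i + 1) (Nat.succ_le_of_lt i.2)
      omega
  refine ⟨π, ?_, ?_⟩
  · rintro ⟨a, b, c, hab, hbc, hcb, hba⟩
    have hdec : ∀ u v : Fin n, u < v → π v < π u → M (v + 1) = M v := by
      intro u v huv hvu
      rcases hcase v with hv | hv
      · have h4 := hS v hv
        have h5 := hlt u
        have h6 : M (u + 1) ≤ M v := hmono (Nat.succ_le_of_lt huv)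
        rw [Fin.lt_def] at hvu
        omega
      · exact hv
    exact lt_asymm hcb (hC b c (hdec a b hab hba) (hdec b c hbc hcb) hbc)
  · have key : ∀ i, i ≤ n → runMax π i = M i := by
      intro i
      induction i with
      | zero => simp [runMax_zero, h0]
      | succ i ih =>
        intro hi
        have h4 := runMax_succ π ⟨i, hi⟩
        have h5 := hcase ⟨i, hi⟩
        have h6 := hS ⟨i, hi⟩
        have h7 := hlt ⟨i, hi⟩
        have h8 := ih (by omega)
        simp only at h4 h5 h6 h7
        omega
    ext i
    rcases le_total i n with hi | hi
    · exact key i hi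
    · rw [runMax_of_le π hi, h3 i hi]

theorem coeff_maxSum (x : ℕ → R) (n v k : ℕ) : (maxSum x n v).coeff k =
    ∑ M ∈ maxSeqs n v with maxBlocks n M = k, ∏ i ∈ maxDes n M, x i := by
  rw [maxSum, finsetSum_coeff, sum_filter]
  refine sum_congr rfl fun M _ => ?_
  rw [maxWeight, ← map_prod, coeff_C_mul, coeff_X_pow, mul_ite, mul_one, mul_zero]
  simp only [eq_comm]

theorem sum_Bl_eq_coeff (n k : ℕ) : ∑ π ∈ Bl n k, monom (permDes π) =
    (maxSum (MvPolynomial.X : ℕ → MvPolynomial ℕ ℤ) n n).coeff k := by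
  rw [coeff_maxSum]
  refine sum_bij (fun π _ => runMax π) ?_ ?_ ?_ ?_
  · intro π hπ
    obtain ⟨-, -, hk⟩ := mem_filter.1 hπ
    exact mem_filter.2 ⟨runMax_mem_maxSeqs π, by rw [← blockNumber_eq, hk]⟩
  · intro π hπ σ hσ h
    exact (mem_filter.1 hπ).2.1.eq_of_runMax_eq (mem_filter.1 hσ).2.1 h
  · intro M hM
    obtain ⟨hM, hk⟩ := mem_filter.1 hM
    obtain ⟨π, hπ, rfl⟩ := exists_avoids321_runMax_eq hM
    exact ⟨π, mem_filter.2 ⟨mem_univ _, hπ, by rw [blockNumber_eq, hk]⟩, rfl⟩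
  · intro π hπ
    rw [(mem_filter.1 hπ).2.1.permDes_eq, monom]

/-! ### Two-row standard tableaux and ballot sets -/

theorem mem_twoRow {a b : ℕ} (h : b ≤ a) (c : ℕ × ℕ) :
    c ∈ (twoRow a b h).cells ↔ c.1 = 0 ∧ c.2 < a ∨ c.1 = 1 ∧ c.2 < b := by
  obtain ⟨i, j⟩ := c
  rw [YoungDiagram.mem_cells, twoRow, YoungDiagram.mem_ofRowLens]
  rcases i with _ | _ | i <;> simp

theorem card_twoRow {a b : ℕ} (h : b ≤ a) : (twoRow a b h).card = a + b := by
  have : (twoRow a b h).cells = (range a).map ⟨Prod.mk 0, Prod.mk_right_injective 0⟩ ∪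
      (range b).map ⟨Prod.mk 1, Prod.mk_right_injective 1⟩ := by
    ext ⟨i, j⟩
    rw [mem_twoRow h]
    simp only [mem_union, mem_map, mem_range, Function.Embedding.coeFn_mk, Prod.mk.injEq]
    constructor
    · rintro (⟨hi, hj⟩ | ⟨hi, hj⟩)
      · exact Or.inl ⟨j, hj, hi.symm, rfl⟩
      · exact Or.inr ⟨j, hj, hi.symm, rfl⟩
    · rintro (⟨j', hj, hi, rfl⟩ | ⟨j', hj, hi, rfl⟩)
      · exact Or.inl ⟨hi.symm, hj⟩
      · exact Or.inr ⟨hi.symm, hj⟩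
  rw [YoungDiagram.card, this, card_union_of_disjoint, card_map, card_map, card_range, card_range]
  rw [disjoint_left]
  simp

section Tableau

variable {a b : ℕ} {hba : b ≤ a}
  (T : {c // c ∈ (twoRow a b hba).cells} ≃ Fin (twoRow a b hba).card)

/-- The set of zero-based entries in the second row. -/
def secondRow : Finset ℕ :=
  ({i : Fin (twoRow a b hba).card | (T.symm i).1.1 = 1} : Finset _).image Fin.val

theorem mem_secondRow {m : ℕ} :
    m ∈ secondRow T ↔ ∃ c, (c : {c // c ∈ (twoRow a b hba).cells}).1.1 = 1 ∧ (T c : ℕ) = m := by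
  simp only [secondRow, mem_image, mem_filter, mem_univ, true_and]
  constructor
  · rintro ⟨i, hi, rfl⟩
    exact ⟨T.symm i, hi, by simp⟩
  · rintro ⟨c, hc, rfl⟩
    exact ⟨T c, by simpa using hc, rfl⟩

theorem val_mem_secondRow (c : {c // c ∈ (twoRow a b hba).cells}) :
    (T c : ℕ) ∈ secondRow T ↔ c.1.1 = 1 := by
  rw [mem_secondRow]
  constructor
  · rintro ⟨d, hd, h⟩
    rwa [← T.injective (Fin.ext h)]
  · exact fun h => ⟨c, h, rfl⟩

theorem row_eq_zero_or_one (c : {c // c ∈ (twoRow a b hba).cells}) : c.1.1 = 0 ∨ c.1.1 = 1 := by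
  have := (mem_twoRow hba c.1).1 c.2
  omega

theorem secondRow_subset : secondRow T ⊆ range (a + b) := by
  intro m hm
  obtain ⟨c, -, rfl⟩ := (mem_secondRow T).1 hm
  rw [mem_range, ← card_twoRow hba]
  exact (T c).2

theorem exists_cell {r s : ℕ} (h : r = 0 ∧ s < a ∨ r = 1 ∧ s < b) :
    ∃ c : {c // c ∈ (twoRow a b hba).cells}, c.1 = (r, s) :=
  ⟨⟨(r, s), (mem_twoRow hba _).2 h⟩, rfl⟩

variable {T}

/-- In a standard tableau, the column of an entry is the number of smaller entries in its row. -/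
theorem IsStandard.card_row (hT : IsStandard T) (c : {c // c ∈ (twoRow a b hba).cells}) :
    #{d : {c // c ∈ (twoRow a b hba).cells} | d.1.1 = c.1.1 ∧ T d < T c} = c.1.2 := by
  rw [← card_range c.1.2]
  refine card_bij (fun d _ => d.1.2) ?_ ?_ ?_
  · intro d hd
    simp only [mem_filter, mem_univ, true_and] at hd
    rw [mem_range]
    by_contra! hle
    rcases hle.eq_or_lt with h | h
    · rw [Subtype.ext (Prod.ext hd.1 h.symm)] at hd
      exact lt_irrefl _ hd.2
    · exact lt_asymm hd.2 (hT.1 c d hd.1.symm h)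
  · intro d hd e he h
    simp only [mem_filter, mem_univ, true_and] at hd he
    exact Subtype.ext (Prod.ext (hd.1.trans he.1.symm) h)
  · intro s hs
    have hs := mem_range.1 hs
    have hc := (mem_twoRow hba c.1).1 c.2
    obtain ⟨d, hd⟩ := exists_cell (hba := hba) (r := c.1.1) (s := s) (by omega)
    refine ⟨d, ?_, by rw [hd]⟩
    simp only [mem_filter, mem_univ, true_and]
    exact ⟨by rw [hd], hT.1 d c (by rw [hd]) (by rw [hd]; exact hs)⟩

variable (T) in
theorem card_secondRow_lt {i : ℕ} : #{j ∈ secondRow T | j < i} =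
    #{d : {c // c ∈ (twoRow a b hba).cells} | d.1.1 = 1 ∧ (T d : ℕ) < i} := by
  symm
  refine card_bij (fun d _ => (T d : ℕ)) ?_ ?_ ?_
  · intro d hd
    simp only [mem_filter, mem_univ, true_and] at hd ⊢
    exact ⟨(val_mem_secondRow T d).2 hd.1, hd.2⟩
  · exact fun d _ e _ h => T.injective (Fin.ext h)
  · intro m hm
    obtain ⟨hm, hi⟩ := mem_filter.1 hm
    obtain ⟨d, hd, rfl⟩ := (mem_secondRow T).1 hm
    exact ⟨d, by simp [hd, hi], rfl⟩

variable (T) in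
theorem card_firstRow_lt {i : ℕ} (hi : i ≤ a + b) : #{j ∈ secondRow T | j < i} +
    #{d : {c // c ∈ (twoRow a b hba).cells} | d.1.1 = 0 ∧ (T d : ℕ) < i} = i := by
  rw [card_secondRow_lt, ← card_union_of_disjoint]
  · rw [← card_range i]
    refine card_bij (fun d _ => (T d : ℕ)) ?_ ?_ ?_
    · intro d hd
      simp only [mem_union, mem_filter, mem_univ, true_and] at hd
      rw [card_range] at hd
      rw [mem_range]
      omega
    · exact fun d _ e _ h => T.injective (Fin.ext h)
    · intro m hm
      have hm := mem_range.1 hm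
      have hd : (T (T.symm ⟨m, by rw [card_twoRow]; omega⟩) : ℕ) = m := by simp
      refine ⟨_, ?_, hd⟩
      have := row_eq_zero_or_one (T.symm ⟨m, by rw [card_twoRow]; omega⟩)
      simp only [mem_union, mem_filter, mem_univ, true_and, card_range]
      omega
  · rw [disjoint_left]
    intro d hd he
    simp only [mem_filter, mem_univ, true_and] at hd he
    omega

theorem IsStandard.isBallot (hT : IsStandard T) : IsBallot (secondRow T) := by
  have key : ∀ i, i ≤ a + b → 2 * #{j ∈ secondRow T | j < i} ≤ i := by
    intro i hi
    have h1 := card_firstRow_lt T hi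
    have h2 : #{j ∈ secondRow T | j < i} ≤
        #{d : {c // c ∈ (twoRow a b hba).cells} | d.1.1 = 0 ∧ (T d : ℕ) < i} := by
      rw [card_secondRow_lt]
      have hex : ∀ d : {c // c ∈ (twoRow a b hba).cells},
          ∃ e : {c // c ∈ (twoRow a b hba).cells}, e.1 = (0, d.1.2) := fun d =>
        exists_cell (by have := (mem_twoRow hba d.1).1 d.2; omega)
      choose e he using hex
      refine card_le_card_of_injOn e ?_ ?_
      · intro d hd
        simp only [coe_filter, mem_univ, true_and, Set.mem_ofPred_eq] at hd ⊢
        have : T (e d) < T d := hT.2 _ _ (by rw [he]) (by rw [he, hd.1]; exact Nat.zero_lt_one)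
        refine ⟨by rw [he], ?_⟩
        rw [Fin.lt_def] at this
        omega
      · intro c hc d hd h
        simp only [coe_filter, mem_univ, true_and, Set.mem_ofPred_eq] at hc hd
        have := he c
        rw [h, he d] at this
        exact Subtype.ext (Prod.ext (hc.1.trans hd.1.symm) (Prod.ext_iff.1 this).2.symm)
    omega
  intro i
  rcases le_total i (a + b) with hi | hi
  · exact key i hi
  · have := key _ le_rfl
    rw [filter_lt_eq_self (secondRow_subset T) le_rfl] at this
    rw [filter_lt_eq_self (secondRow_subset T) hi]
    omega

variable (T) in
theorem card_secondRow : #(secondRow T) = b := by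
  rw [← filter_lt_eq_self (secondRow_subset T) le_rfl, card_secondRow_lt]
  refine (?_ : _ = #(range b)).trans (card_range b)
  refine card_bij (fun d _ => d.1.2) ?_ ?_ ?_
  · intro d hd
    simp only [mem_filter, mem_univ, true_and] at hd
    have := (mem_twoRow hba d.1).1 d.2
    rw [mem_range]
    omega
  · intro d hd e he h
    simp only [mem_filter, mem_univ, true_and] at hd he
    exact Subtype.ext (Prod.ext (hd.1.trans he.1.symm) h)
  · intro s hs
    have hs := mem_range.1 hs
    obtain ⟨d, hd⟩ := exists_cell (hba := hba) (r := 1) (s := s) (by omega)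
    refine ⟨d, ?_, by rw [hd]⟩
    simp only [mem_filter, mem_univ, true_and]
    refine ⟨by rw [hd], ?_⟩
    rw [← card_twoRow hba]
    exact (T d).2

/-- The cell of the entry `i` in a standard tableau, in terms of the second row. -/
theorem IsStandard.cell_eq (hT : IsStandard T) (c : {c // c ∈ (twoRow a b hba).cells}) :
    c.1 = if (T c : ℕ) ∈ secondRow T then (1, #{j ∈ secondRow T | j < (T c : ℕ)})
      else (0, (T c : ℕ) - #{j ∈ secondRow T | j < (T c : ℕ)}) := by
  have h := hT.card_row c
  have h2 := card_firstRow_lt T (i := T c) (by rw [← card_twoRow hba]; exact (T c).2.le)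
  rcases row_eq_zero_or_one c with hc | hc
  · rw [if_neg (by rw [val_mem_secondRow]; omega)]
    simp only [hc, Fin.lt_def] at h
    exact Prod.ext hc (by simp only []; omega)
  · rw [if_pos (by rw [val_mem_secondRow]; omega), card_secondRow_lt]
    simp only [hc, Fin.lt_def] at h
    exact Prod.ext hc h.symm

theorem IsStandard.eq_of_secondRow_eq
    {T' : {c // c ∈ (twoRow a b hba).cells} ≃ Fin (twoRow a b hba).card}
    (hT : IsStandard T) (hT' : IsStandard T') (h : secondRow T = secondRow T') : T = T' := by
  rw [← T.symm_symm, ← T'.symm_symm]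
  congr 1
  ext1 i
  have h1 := hT.cell_eq (T.symm i)
  have h2 := hT'.cell_eq (T'.symm i)
  rw [T.apply_symm_apply, h] at h1
  rw [T'.apply_symm_apply] at h2
  exact Subtype.ext (h1.trans h2.symm)

end Tableau

theorem card_filter_lt_succ (C : Finset ℕ) (i : ℕ) :
    #{j ∈ C | j < i + 1} = #{j ∈ C | j < i} + if i ∈ C then 1 else 0 := by
  have : {j ∈ C | j < i + 1} = {j ∈ C | j < i} ∪ {j ∈ C | j = i} := by
    ext j
    simp only [mem_filter, mem_union]
    grind
  rw [this, card_union_of_disjoint, filter_eq' C i]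
  · split_ifs <;> simp
  · rw [disjoint_left]
    intro j hj hj'
    have := (mem_filter.1 hj).2
    have := (mem_filter.1 hj').2
    omega

theorem exists_isStandard_secondRow_eq {a b : ℕ} (hba : b ≤ a) {C : Finset ℕ}
    (hC : C ⊆ range (a + b)) (hB : IsBallot C) (hcard : #C = b) :
    ∃ T : {c // c ∈ (twoRow a b hba).cells} ≃ Fin (twoRow a b hba).card,
      IsStandard T ∧ secondRow T = C := by
  -- `u i` and `r i` count the entries below `i` in the first and in the second row.
  set r : ℕ → ℕ := fun i => #{j ∈ C | j < i} with hr
  set u : ℕ → ℕ := fun i => i - r i with hu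
  have hrs : ∀ i, r (i + 1) = r i + if i ∈ C then 1 else 0 := card_filter_lt_succ C
  have hri : ∀ i, 2 * r i ≤ i := hB
  have hus : ∀ i, u (i + 1) = u i + if i ∈ C then 0 else 1 := fun i => by
    have := hri i
    have := hrs i
    simp only [hu]
    split_ifs with h <;> simp [h] at this ⊢ <;> omega
  have hrm : Monotone r := monotone_nat_of_le_succ fun i => by rw [hrs]; omega
  have hum : Monotone u := monotone_nat_of_le_succ fun i => by rw [hus]; omega
  have hrN : r (a + b) = b := by simp only [hr, filter_lt_eq_self hC le_rfl, hcard]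
  have huN : u (a + b) = a := by simp only [hu, hrN]; omega
  have hrlt : ∀ {i j}, i ∈ C → i < j → r i < r j := fun {i j} hi hij => by
    have h1 := hrm (Nat.succ_le_of_lt hij)
    rw [Nat.succ_eq_add_one, hrs, if_pos hi] at h1
    omega
  have hult : ∀ {i j}, i ∉ C → i < j → u i < u j := fun {i j} hi hij => by
    have h1 := hum (Nat.succ_le_of_lt hij)
    rw [Nat.succ_eq_add_one, hus, if_neg hi] at h1
    omega
  let p : Fin (twoRow a b hba).card → {c // c ∈ (twoRow a b hba).cells} := fun i =>
    ⟨if (i : ℕ) ∈ C then (1, r i) else (0, u i), by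
      have hi : (i : ℕ) < a + b := by rw [← card_twoRow hba]; exact i.2
      rw [mem_twoRow]
      split_ifs with h
      · have := hrlt h hi
        exact Or.inr ⟨rfl, by simp only []; omega⟩
      · have := hult h hi
        exact Or.inl ⟨rfl, by simp only []; omega⟩⟩
  have hp1 : ∀ i : Fin _, (i : ℕ) ∈ C → (p i).1 = (1, r i) := fun i h => if_pos h
  have hp0 : ∀ i : Fin _, (i : ℕ) ∉ C → (p i).1 = (0, u i) := fun i h => if_neg h
  have hinj : Function.Injective p := by
    intro i j h
    have h := congrArg Subtype.val h
    apply Fin.ext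
    by_cases hi : (i : ℕ) ∈ C <;> by_cases hj : (j : ℕ) ∈ C
    · rw [hp1 i hi, hp1 j hj] at h
      have h : r i = r j := (Prod.ext_iff.1 h).2
      rcases lt_trichotomy (i : ℕ) j with hij | hij | hij
      · exact absurd h (hrlt hi hij).ne
      · exact hij
      · exact absurd h (hrlt hj hij).ne'
    · simp [hp1 i hi, hp0 j hj] at h
    · simp [hp0 i hi, hp1 j hj] at h
    · rw [hp0 i hi, hp0 j hj] at h
      have h : u i = u j := (Prod.ext_iff.1 h).2
      rcases lt_trichotomy (i : ℕ) j with hij | hij | hij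
      · exact absurd h (hult hi hij).ne
      · exact hij
      · exact absurd h (hult hj hij).ne'
  have hbij : Function.Bijective p := by
    rw [Fintype.bijective_iff_injective_and_card]
    refine ⟨hinj, ?_⟩
    rw [Fintype.card_fin, Fintype.card_coe, YoungDiagram.card]
  let e := Equiv.ofBijective p hbij
  have he : ∀ i, e i = p i := fun i => rfl
  refine ⟨e.symm, ⟨fun c d => ?_, fun c d => ?_⟩, ?_⟩
  · obtain ⟨i, rfl⟩ := e.surjective c
    obtain ⟨j, rfl⟩ := e.surjective d
    simp only [Equiv.symm_apply_apply]
    simp only [he]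
    intro h1 h2
    by_contra! hji
    have hji : (j : ℕ) ≤ i := hji
    have := hrm hji
    have := hum hji
    by_cases hi : (i : ℕ) ∈ C <;> by_cases hj : (j : ℕ) ∈ C
    · simp only [hp1 i hi, hp1 j hj] at h1 h2
      omega
    · simp [hp1 i hi, hp0 j hj] at h1
    · simp [hp0 i hi, hp1 j hj] at h1
    · simp only [hp0 i hi, hp0 j hj] at h1 h2
      omega
  · obtain ⟨i, rfl⟩ := e.surjective c
    obtain ⟨j, rfl⟩ := e.surjective d
    simp only [Equiv.symm_apply_apply]
    simp only [he]
    intro h1 h2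
    by_contra! hji
    have hji : (j : ℕ) ≤ i := hji
    by_cases hi : (i : ℕ) ∈ C <;> by_cases hj : (j : ℕ) ∈ C
    · simp [hp1 i hi, hp1 j hj] at h2
    · simp [hp1 i hi, hp0 j hj] at h2
    · simp only [hp0 i hi, hp1 j hj] at h1 h2
      -- The ballot condition for the entries up to `j` exhibits enough entries in the first row.
      have hlt : (j : ℕ) < i := lt_of_le_of_ne hji fun h => hi (h ▸ hj)
      have h3 := hum (Nat.succ_le_of_lt hlt)
      have h4 := hri (j + 1)
      have h5 := hrs j
      rw [if_pos hj] at h5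
      simp only [hu, Nat.succ_eq_add_one] at h1 h3
      omega
    · simp [hp0 i hi, hp0 j hj] at h2
  · ext m
    simp only [secondRow, mem_image, mem_filter, mem_univ, true_and, Equiv.symm_symm, he]
    constructor
    · rintro ⟨i, hi, rfl⟩
      by_contra hiC
      simp [hp0 i hiC] at hi
    · intro hm
      have : m < (twoRow a b hba).card := by
        rw [card_twoRow]
        exact mem_range.1 (hC hm)
      exact ⟨⟨m, this⟩, by rw [hp1 _ hm], rfl⟩

theorem tabDes_secondRow {a b : ℕ} {hba : b ≤ a}
    {T : {c // c ∈ (twoRow a b hba).cells} ≃ Fin (twoRow a b hba).card} :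
    tabDes T = ballotDes (secondRow T) := by
  have hrow : ∀ i : Fin (twoRow a b hba).card, (T.symm i).1.1 = 1 ↔ (i : ℕ) ∈ secondRow T :=
    fun i => by rw [← val_mem_secondRow, T.apply_symm_apply]
  ext m
  simp only [tabDes, ballotDes, mem_image, mem_filter, mem_univ, true_and]
  constructor
  · rintro ⟨i, ⟨hi, h⟩, rfl⟩
    have h1 := row_eq_zero_or_one (T.symm i)
    have h2 := row_eq_zero_or_one (T.symm ⟨i + 1, hi⟩)
    rw [Nat.add_sub_cancel, ← hrow i]
    exact ⟨(hrow ⟨i + 1, hi⟩).1 (by omega), by omega⟩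
  · rintro ⟨hm, hm'⟩
    obtain ⟨i, rfl⟩ : ∃ i, m = i + 1 := ⟨m - 1, by
      rcases Nat.eq_zero_or_pos m with rfl | h
      · exact absurd hm hm'
      · omega⟩
    have hi : i + 1 < (twoRow a b hba).card := by
      rw [card_twoRow]
      exact mem_range.1 (secondRow_subset T hm)
    rw [Nat.add_sub_cancel] at hm'
    refine ⟨⟨i, by omega⟩, ⟨hi, ?_⟩, rfl⟩
    have h1 := row_eq_zero_or_one (T.symm ⟨i, by omega⟩)
    have h2 := (hrow ⟨i + 1, hi⟩).2 hm
    have h3 := mt (hrow ⟨i, by omega⟩).1 hm'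
    simp only at h2 ⊢
    omega

theorem sum_SYT_twoRow {A : Type*} [AddCommMonoid A] {a b h : ℕ} (hba : b ≤ a) (hh : b + h = a)
    (f : Finset ℕ → A) : ∑ T ∈ SYT (twoRow a b hba), f (tabDes T) =
      ∑ C ∈ ballotSets (a + b) h, f (ballotDes C) := by
  refine sum_bij (fun T _ => secondRow T) ?_ ?_ ?_ ?_
  · intro T hT
    have hT := (mem_filter.1 hT).2
    exact mem_ballotSets.2 ⟨secondRow_subset T, hT.isBallot, by rw [card_secondRow]; omega⟩
  · exact fun T hT T' hT' h => (mem_filter.1 hT).2.eq_of_secondRow_eq (mem_filter.1 hT').2 h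
  · intro C hC
    obtain ⟨h1, h2, h3⟩ := mem_ballotSets.1 hC
    obtain ⟨T, hT, rfl⟩ := exists_isStandard_secondRow_eq hba h1 h2 (by omega)
    exact ⟨T, mem_filter.2 ⟨mem_univ _, hT⟩, rfl⟩
  · intro T _
    rw [tabDes_secondRow]

theorem sum_SYT_eq_ballotSum {n a b h : ℕ} (hba : b ≤ a) (hh : b + h = a) :
    ∑ T ∈ SYT (twoRow a b hba), monom (tabDes T ∩ Icc 1 (n - 1)) =
      ballotSum (fun i => if i < n then MvPolynomial.X i else 1 : ℕ → MvPolynomial ℕ ℤ)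
        (a + b) h := by
  rw [sum_SYT_twoRow hba hh fun I => monom (I ∩ Icc 1 (n - 1)), ballotSum]
  refine sum_congr rfl fun C _ => ?_
  rw [monom, ← prod_filter]
  refine prod_congr ?_ fun _ _ => rfl
  ext i
  simp only [mem_inter, mem_filter, mem_Icc]
  constructor
  · rintro ⟨h1, h2⟩
    exact ⟨h1, by omega⟩
  · rintro ⟨h1, h2⟩
    refine ⟨h1, ?_, by omega⟩
    rcases Nat.eq_zero_or_pos i with rfl | hi
    · simp [ballotDes] at h1
    · exact hi

/-! ### Truncating the descents -/

/-- A ballot sum depends only on the weights of positions before its length. -/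
theorem ballotSum_congr {x y : ℕ → R} {n : ℕ} (h : ∀ i < n, x i = y i)
    (k : ℕ) : ballotSum x n k = ballotSum y n k := by
  refine sum_congr rfl fun C hC => prod_congr rfl fun i hi => h i ?_
  exact mem_range.1 ((mem_ballotSets.1 hC).1 (mem_filter.1 hi).1)

end BlockNumber

theorem corollary5p2 (n k : ℕ) (hk : 1 ≤ k) (hkn : k ≤ n) :
    ∑ π ∈ BlockNumber.Bl n k, BlockNumber.monom (BlockNumber.permDes π) =
      ∑ T ∈ BlockNumber.SYT (BlockNumber.twoRow (n - 1) (n - k) (Nat.sub_le_sub_left hk n)),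
        BlockNumber.monom (BlockNumber.tabDes T ∩ Finset.Icc 1 (n - 1)) := by
  open BlockNumber in
  rw [sum_Bl_eq_coeff, sum_SYT_eq_ballotSum (h := k - 1) _ (by omega)]
  set x : ℕ → MvPolynomial ℕ ℤ := MvPolynomial.X
  set y : ℕ → MvPolynomial ℕ ℤ := fun i => if i < n then x i else 1
  have ha := isMaxRec_maxSum x
  have hb := isBallotRec_ballotSum y
  rcases hkn.eq_or_lt with rfl | hlt
  · have h1 := (ha.coeff_top k).2.2
    have h2 := (hb.support (k - 1)).2
    rw [Nat.sub_self, add_zero, h2]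
    exact h1
  · have h1 := (ha.coeff_eq (isBallotRec_ballotSum x) n).1 (n - k - 1) (k - 1) (by omega)
    rw [Nat.sub_add_cancel hk] at h1
    have h2 := hb.add_eq_pow (n := n) (by omega) (fun i hi => if_neg (by omega)) (n - k - 1)
    have h3 : ballotSum y n = ballotSum x n :=
      funext (ballotSum_congr (x := y) (y := x) fun i hi => if_pos hi)
    rw [show n - 1 + (n - k) = n + (n - k - 1) by omega, h2, h3]
    exact h1
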